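/- Let $K$ be a field and let $C$ be a $K$-coalgebra satisfying the right generating condition: every right $C$-comodule is a quotient of a direct sum of copies of $C$. Let $C^*=\mathrm{Hom}_K(C,K)$ be the dual algebra with the convolution product $(fg)(c)=f(c_1)g(c_2)$; a right $C$-comodule $M$ is a left $C^*$-module through $f\cdot m=f(m_1)m_0$, and a left $C$-comodule is a right $C^*$-module through $m\cdot f=f(m_{-1})m_0$. Let $S$ be a simple left $C$-comodule whose injective envelope $E(S)$ in the category of left $C$-comodules has finite Loewy length as a right $C^*$-module; that is, $L_n(E(S))=E(S)$ for some $n\ge 0$, where $L_0=0$ and $L_{k+1}/L_k$ is the socle of $E(S)/L_k$. Then $E(S)$ is finite dimensional over $K$, and there is a simple right $C$-comodule $T$ with injective envelope $E(T)$ in the category of right $C$-comodules such that $E(S)\cong E(T)^*$ as right $C^*$-modules, where $E(T)^*=\mathrm{Hom}_K(E(T),K)$ has the action $(\mu\cdot f)(x)=\mu(f\cdot x)$. -/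

import Mathlib

open scoped TensorProduct

universe u

/-! ## Comodules over a coalgebra -/

section Comodules

variable (K : Type u) (C : Type u) [Field K] [AddCommGroup C] [Module K C] [Coalgebra K C]

/-- A right comodule `(M, ρ)` over the `K`-coalgebra `C`, with `ρ : M → M ⊗ C`. -/
class RightComodule (M : Type u) [AddCommGroup M] [Module K M] where
  /-- The coaction `ρ(m) = m₀ ⊗ m₁`. -/
  coact : M →ₗ[K] M ⊗[K] C
  coassoc : TensorProduct.assoc K M C C ∘ₗ coact.rTensor C ∘ₗ coact =
    (Coalgebra.comul (R := K) (A := C)).lTensor M ∘ₗ coact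
  counit_coact : (Coalgebra.counit (R := K) (A := C)).lTensor M ∘ₗ coact =
    (TensorProduct.mk K M K).flip 1

/-- A left comodule `(M, λ)` over the `K`-coalgebra `C`, with `λ : M → C ⊗ M`. -/
class LeftComodule (M : Type u) [AddCommGroup M] [Module K M] where
  /-- The coaction `λ(m) = m₋₁ ⊗ m₀`. -/
  coact : M →ₗ[K] C ⊗[K] M
  coassoc : TensorProduct.assoc K C C M ∘ₗ
      (Coalgebra.comul (R := K) (A := C)).rTensor M ∘ₗ coact =
    coact.lTensor C ∘ₗ coact
  counit_coact : (Coalgebra.counit (R := K) (A := C)).rTensor M ∘ₗ coact =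
    TensorProduct.mk K K M 1

/-- `C` as a right comodule over itself, through its comultiplication. -/
instance RightComodule.self : RightComodule K C C where
  coact := Coalgebra.comul
  coassoc := Coalgebra.coassoc
  counit_coact := Coalgebra.lTensor_counit_comp_comul

/-- The dual algebra `C^*`, with the convolution product `(f * g)(c) = f(c₁) g(c₂)` and unit
the counit of `C`. -/
abbrev DualAlgebra : Type u := WithConv (C →ₗ[K] K)

end Comodules

/-! ## Right comodules -/

namespace RightComodule

section

variable (K : Type u) (C : Type u) [Field K] [AddCommGroup C] [Module K C] [Coalgebra K C]
variable {M : Type u} [AddCommGroup M] [Module K M] [RightComodule K C M]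
variable {N : Type u} [AddCommGroup N] [Module K N] [RightComodule K C N]

/-- The linear map `M ⊗ C → M`, `m ⊗ c ↦ f(c) m`. -/
noncomputable def contract (M : Type u) [AddCommGroup M] [Module K M] (f : C →ₗ[K] K) :
    M ⊗[K] C →ₗ[K] M :=
  (TensorProduct.rid K M).toLinearMap ∘ₗ f.lTensor M

variable {K C} in
theorem contract_mul (f g : DualAlgebra K C) (m : M) :
    contract K C M (f * g).ofConv (coact m) =
      contract K C M f.ofConv (coact (contract K C M g.ofConv (coact (C := C) m))) := by
  have key : ∀ t : M ⊗[K] C, contract K C M f.ofConv (coact (contract K C M g.ofConv t)) =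
      contract K C M f.ofConv ((TensorProduct.rid K (M ⊗[K] C)).toLinearMap
        (g.ofConv.lTensor (M ⊗[K] C) ((coact (K := K) (C := C) (M := M)).rTensor C t))) := by
    intro t
    induction t using TensorProduct.induction_on with
    | zero => simp
    | tmul x c => simp [contract]
    | add x y hx hy => simp only [map_add, hx, hy]
  have key2 : ∀ t : (M ⊗[K] C) ⊗[K] C,
      contract K C M f.ofConv ((TensorProduct.rid K (M ⊗[K] C)).toLinearMap
        (g.ofConv.lTensor (M ⊗[K] C) t)) =
      (TensorProduct.rid K M).toLinearMap
        ((LinearMap.mul' K K ∘ₗ TensorProduct.map f.ofConv g.ofConv).lTensor M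
          (TensorProduct.assoc K M C C t)) := by
    intro t
    induction t using TensorProduct.induction_on with
    | zero => simp
    | tmul x c =>
      induction x using TensorProduct.induction_on with
      | zero => simp
      | tmul x d => simp [contract, smul_smul, mul_comm]
      | add x y hx hy => simp only [TensorProduct.add_tmul, map_add, hx, hy]
    | add x y hx hy => simp only [map_add, hx, hy]
  have h := LinearMap.congr_fun (coassoc (K := K) (C := C) (M := M)) m
  simp only [LinearMap.comp_apply, LinearEquiv.coe_coe] at h
  rw [key, key2, h, ← LinearMap.comp_apply (LinearMap.lTensor M _), ← LinearMap.lTensor_comp]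
  rfl

/-- A right comodule is a left `C^*`-module through `f · m = f(m₁) m₀`. -/
noncomputable instance module : Module (DualAlgebra K C) M where
  smul f m := contract K C M f.ofConv (coact m)
  one_smul m := by
    have h := LinearMap.congr_fun (counit_coact (K := K) (C := C) (M := M)) m
    have h1 : (1 : DualAlgebra K C).ofConv = Coalgebra.counit := by
      ext c; simp [LinearMap.convOne_def]
    change (TensorProduct.rid K M) ((1 : DualAlgebra K C).ofConv.lTensor M (coact m)) = m
    simp only [LinearMap.comp_apply] at h
    rw [h1, h]
    simp
  mul_smul f g m := contract_mul f g m
  smul_zero f := by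
    change contract K C M f.ofConv (coact (0 : M)) = 0
    simp
  smul_add f x y := by
    change contract K C M f.ofConv (coact (x + y)) =
      contract K C M f.ofConv (coact x) + contract K C M f.ofConv (coact y)
    simp
  add_smul f g m := by
    change contract K C M (f + g).ofConv (coact m) =
      contract K C M f.ofConv (coact m) + contract K C M g.ofConv (coact m)
    simp [contract, LinearMap.lTensor_add]
  zero_smul m := by
    change contract K C M (0 : DualAlgebra K C).ofConv (coact m) = 0
    simp [contract]

/-- Morphisms of right comodules: linear maps `φ` with `ρ ∘ φ = (φ ⊗ id) ∘ ρ`. -/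
def IsHom (φ : M →ₗ[K] N) : Prop :=
  coact ∘ₗ φ = φ.rTensor C ∘ₗ coact (K := K) (C := C) (M := M)

/-- Subcomodules: subspaces `U` with `ρ(U) ⊆ U ⊗ C`. -/
def IsSubcomodule (U : Submodule K M) : Prop :=
  ∀ x ∈ U, coact (C := C) x ∈ LinearMap.range (U.subtype.rTensor C)

variable (M) in
/-- Simple right comodules. -/
def IsSimple : Prop :=
  Nontrivial M ∧ ∀ U : Submodule K M, IsSubcomodule K C U → U = ⊥ ∨ U = ⊤

end

section

variable (K : Type u) (C : Type u) [Field K] [AddCommGroup C] [Module K C] [Coalgebra K C]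

/-- Injective objects of the category of right comodules. -/
def IsInjective (E : Type u) [AddCommGroup E] [Module K E] [RightComodule K C E] : Prop :=
  ∀ (X Y : Type u) [AddCommGroup X] [Module K X] [RightComodule K C X]
    [AddCommGroup Y] [Module K Y] [RightComodule K C Y]
    (g : X →ₗ[K] Y) (φ : X →ₗ[K] E), IsHom K C g → Function.Injective g → IsHom K C φ →
      ∃ ψ : Y →ₗ[K] E, IsHom K C ψ ∧ ψ ∘ₗ g = φ

/-- `i : S → E` is an injective envelope of the right comodule `S`: an embedding of comodules
with essential image into an injective comodule. -/
structure IsInjectiveEnvelope {S E : Type u} [AddCommGroup S] [Module K S] [RightComodule K C S]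
    [AddCommGroup E] [Module K E] [RightComodule K C E] (i : S →ₗ[K] E) : Prop where
  isHom : IsHom K C i
  injective : Function.Injective i
  isInjective : IsInjective K C E
  essential : ∀ U : Submodule K E, IsSubcomodule K C U → U ⊓ LinearMap.range i = ⊥ → U = ⊥

/-- The right generating condition: `C` generates all its right comodules, i.e. every right
comodule `M` is the sum of the images of the comodule morphisms `C → M` (equivalently, the
canonical morphism to `M` from the direct sum of copies of `C` indexed by these morphisms is
onto). -/
def GeneratingCondition : Prop :=
  ∀ (M : Type u) [AddCommGroup M] [Module K M] [RightComodule K C M],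
    ⨆ φ : {φ : C →ₗ[K] M // IsHom K C φ}, LinearMap.range φ.1 = ⊤

end

end RightComodule

/-! ## Left comodules -/

namespace LeftComodule

section

variable (K : Type u) (C : Type u) [Field K] [AddCommGroup C] [Module K C] [Coalgebra K C]
variable {M : Type u} [AddCommGroup M] [Module K M] [LeftComodule K C M]
variable {N : Type u} [AddCommGroup N] [Module K N] [LeftComodule K C N]

/-- The linear map `C ⊗ M → M`, `c ⊗ m ↦ f(c) m`. -/
noncomputable def contract (M : Type u) [AddCommGroup M] [Module K M] (f : C →ₗ[K] K) :
    C ⊗[K] M →ₗ[K] M :=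
  (TensorProduct.lid K M).toLinearMap ∘ₗ f.rTensor M

variable {K C} in
theorem contract_mul (f g : DualAlgebra K C) (m : M) :
    contract K C M (f * g).ofConv (coact m) =
      contract K C M g.ofConv (coact (contract K C M f.ofConv (coact (C := C) m))) := by
  have key : ∀ t : C ⊗[K] M, contract K C M g.ofConv (coact (contract K C M f.ofConv t)) =
      contract K C M g.ofConv ((TensorProduct.lid K (C ⊗[K] M)).toLinearMap
        (f.ofConv.rTensor (C ⊗[K] M) ((coact (K := K) (C := C) (M := M)).lTensor C t))) := by
    intro t
    induction t using TensorProduct.induction_on with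
    | zero => simp
    | tmul c x => simp [contract]
    | add x y hx hy => simp only [map_add, hx, hy]
  have key2 : ∀ t : (C ⊗[K] C) ⊗[K] M,
      contract K C M g.ofConv ((TensorProduct.lid K (C ⊗[K] M)).toLinearMap
        (f.ofConv.rTensor (C ⊗[K] M) (TensorProduct.assoc K C C M t))) =
      (TensorProduct.lid K M).toLinearMap
        ((LinearMap.mul' K K ∘ₗ TensorProduct.map f.ofConv g.ofConv).rTensor M t) := by
    intro t
    induction t using TensorProduct.induction_on with
    | zero => simp
    | tmul x m =>
      induction x using TensorProduct.induction_on with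
      | zero => simp
      | tmul c d => simp [contract, smul_smul]
      | add x y hx hy => simp only [TensorProduct.add_tmul, map_add, hx, hy]
    | add x y hx hy => simp only [map_add, hx, hy]
  have h := LinearMap.congr_fun (coassoc (K := K) (C := C) (M := M)) m
  simp only [LinearMap.comp_apply, LinearEquiv.coe_coe] at h
  rw [key, ← h, key2, ← LinearMap.comp_apply (LinearMap.rTensor M _), ← LinearMap.rTensor_comp]
  rfl

/-- A left comodule is a right `C^*`-module through `m · f = f(m₋₁) m₀`. -/
noncomputable instance module : Module (DualAlgebra K C)ᵐᵒᵖ M where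
  smul f m := contract K C M f.unop.ofConv (coact m)
  one_smul m := by
    have h := LinearMap.congr_fun (counit_coact (K := K) (C := C) (M := M)) m
    have h1 : (1 : DualAlgebra K C).ofConv = Coalgebra.counit := by
      ext c; simp [LinearMap.convOne_def]
    change (TensorProduct.lid K M) ((1 : DualAlgebra K C).ofConv.rTensor M (coact m)) = m
    simp only [LinearMap.comp_apply] at h
    rw [h1, h]
    simp
  mul_smul f g m := contract_mul g.unop f.unop m
  smul_zero f := by
    change contract K C M f.unop.ofConv (coact (0 : M)) = 0
    simp
  smul_add f x y := by
    change contract K C M f.unop.ofConv (coact (x + y)) =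
      contract K C M f.unop.ofConv (coact x) + contract K C M f.unop.ofConv (coact y)
    simp
  add_smul f g m := by
    change contract K C M (f.unop + g.unop).ofConv (coact m) =
      contract K C M f.unop.ofConv (coact m) + contract K C M g.unop.ofConv (coact m)
    simp [contract, LinearMap.rTensor_add]
  zero_smul m := by
    change contract K C M (0 : DualAlgebra K C).ofConv (coact m) = 0
    simp [contract]

/-- Morphisms of left comodules: linear maps `φ` with `λ ∘ φ = (id ⊗ φ) ∘ λ`. -/
def IsHom (φ : M →ₗ[K] N) : Prop :=
  coact ∘ₗ φ = φ.lTensor C ∘ₗ coact (K := K) (C := C) (M := M)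

/-- Subcomodules: subspaces `U` with `λ(U) ⊆ C ⊗ U`. -/
def IsSubcomodule (U : Submodule K M) : Prop :=
  ∀ x ∈ U, coact (C := C) x ∈ LinearMap.range (U.subtype.lTensor C)

variable (M) in
/-- Simple left comodules. -/
def IsSimple : Prop :=
  Nontrivial M ∧ ∀ U : Submodule K M, IsSubcomodule K C U → U = ⊥ ∨ U = ⊤

end

section

variable (K : Type u) (C : Type u) [Field K] [AddCommGroup C] [Module K C] [Coalgebra K C]

/-- Injective objects of the category of left comodules. -/
def IsInjective (E : Type u) [AddCommGroup E] [Module K E] [LeftComodule K C E] : Prop :=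
  ∀ (X Y : Type u) [AddCommGroup X] [Module K X] [LeftComodule K C X]
    [AddCommGroup Y] [Module K Y] [LeftComodule K C Y]
    (g : X →ₗ[K] Y) (φ : X →ₗ[K] E), IsHom K C g → Function.Injective g → IsHom K C φ →
      ∃ ψ : Y →ₗ[K] E, IsHom K C ψ ∧ ψ ∘ₗ g = φ

/-- `i : S → E` is an injective envelope of the left comodule `S`: an embedding of comodules
with essential image into an injective comodule. -/
structure IsInjectiveEnvelope {S E : Type u} [AddCommGroup S] [Module K S] [LeftComodule K C S]
    [AddCommGroup E] [Module K E] [LeftComodule K C E] (i : S →ₗ[K] E) : Prop where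
  isHom : IsHom K C i
  injective : Function.Injective i
  isInjective : IsInjective K C E
  essential : ∀ U : Submodule K E, IsSubcomodule K C U → U ⊓ LinearMap.range i = ⊥ → U = ⊥

/-- `E ≅ M^*` for a left comodule `E` and a right comodule `M`, as right `C^*`-modules, where
`M^* = Hom_K(M, K)` carries the dual action `(μ · a)(m) = μ(a · m)`. -/
def IsoDual (E M : Type u) [AddCommGroup E] [Module K E] [LeftComodule K C E]
    [AddCommGroup M] [Module K M] [RightComodule K C M] : Prop :=
  ∃ e : E ≃ₗ[K] Module.Dual K M,
    ∀ (a : DualAlgebra K C) (x : E) (m : M), e (MulOpposite.op a • x) m = e x (a • m)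

end

end LeftComodule

/-! ## The Loewy series of a module -/

section Loewy

variable (R : Type u) (M : Type u) [Ring R] [AddCommGroup M] [Module R M]

/-- The socle of a module: the sum of its simple submodules. -/
def moduleSocle : Submodule R M := sSup {N : Submodule R M | IsSimpleModule R N}

/-- The finite part of the Loewy series: `L₀(M) = 0` and `Lₙ₊₁(M) / Lₙ(M)` is the socle of
`M / Lₙ(M)`. -/
def loewySeries : ℕ → Submodule R M
  | 0 => ⊥
  | n + 1 => (moduleSocle R (M ⧸ loewySeries n)).comap (loewySeries n).mkQ

/-- `M` has finite Loewy length. -/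
def HasFiniteLoewyLength : Prop := ∃ n : ℕ, loewySeries R M n = ⊤

end Loewy

/-! Contractions by functionals separate tensors, so comodule questions become questions about the
action of `C^*`. Let `s` be a nonzero element of the image of `S` in `E`; by essentiality and
simplicity it lies in every nonzero submodule of `E`.

The engine is `exists_smul_eq`. Let `X` be a finite-dimensional submodule of `E` containing `s`. The
generating condition, applied to the right comodule `X^*`, gives a morphism `φ : C → X^*` whose
values do not all vanish at `s`; its transpose is an embedding of right modules `X → C^*`. Since `E`
is a direct summand of `C`, this puts `X` inside a cyclic submodule of `E`. The argument still works
after multiplying the embedding on the left by `a`, as long as `s` is not killed, and the `a` that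
kill it form a proper additive subgroup of `C^*`.

If `E` had two maximal submodules, the product of the two quotients would be semisimple, finite
dimensional and not simple. For such a module the `a` whose multiples never generate it lie in no
proper additive subgroup, a contradiction (`isCoatom_unique`). Finite Loewy length puts every proper
submodule inside a maximal one, so `E` has a largest proper submodule `V`. Any element outside `V`
generates `E`, and cyclic comodules are finite dimensional.

Finally `X = E`, `a = 1` exhibits `E^*` as a direct summand of `C`, hence injective. The annihilator
of `V` is its least nonzero subcomodule, which gives `T`; biduality gives the isomorphism. -/

namespace RightComodule

/-! ### Right comodules through the action of the dual algebra -/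

section

variable {K C : Type u} [Field K] [AddCommGroup C] [Module K C]
variable {M : Type u} [AddCommGroup M] [Module K M]

@[simp]
theorem contract_tmul (f : C →ₗ[K] K) (m : M) (c : C) :
    contract K C M f (m ⊗ₜ[K] c) = f c • m := by
  simp [contract]

theorem ext_dual {c d : C} (h : ∀ f : C →ₗ[K] K, f c = f d) : c = d :=
  (Module.forall_dual_apply_eq_zero_iff K (c - d)).1 (fun f => by
    rw [map_sub, sub_eq_zero]; exact h f) |> sub_eq_zero.1

/-- The components of a tensor along a basis of `C` are its contractions by the coordinate
functionals. -/
theorem eq_of_contract {t t' : M ⊗[K] C}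
    (h : ∀ f : C →ₗ[K] K, contract K C M f t = contract K C M f t') : t = t' := by
  classical
  let b := Module.Basis.ofVectorSpace K C
  apply (TensorProduct.equivFinsuppOfBasisRight b (M := M)).injective
  have key : ∀ (u : M ⊗[K] C) i, TensorProduct.equivFinsuppOfBasisRight b u i =
      contract K C M (b.coord i) u := by
    intro u i
    induction u using TensorProduct.induction_on with
    | zero => simp
    | tmul m c => simp
    | add x y hx hy => simp [hx, hy]
  ext i
  rw [key, key, h]

theorem contract_rTensor {N : Type u} [AddCommGroup N] [Module K N] (φ : M →ₗ[K] N)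
    (f : C →ₗ[K] K) (t : M ⊗[K] C) :
    contract K C N f (φ.rTensor C t) = φ (contract K C M f t) := by
  induction t using TensorProduct.induction_on with
  | zero => simp
  | tmul m c => simp
  | add x y hx hy => simp [hx, hy]

end

section

variable {K C : Type u} [Field K] [AddCommGroup C] [Module K C] [Coalgebra K C]
variable {M : Type u} [AddCommGroup M] [Module K M]

/-- A map `ρ : M → M ⊗ C` whose contractions define an action of `C^*` is a coaction. -/
@[reducible] def ofContract (ρ : M →ₗ[K] M ⊗[K] C)
    (one : ∀ m, contract K C M Coalgebra.counit (ρ m) = m)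
    (mul : ∀ (f g : DualAlgebra K C) (m : M), contract K C M (f * g).ofConv (ρ m) =
      contract K C M f.ofConv (ρ (contract K C M g.ofConv (ρ m)))) : RightComodule K C M where
  coact := ρ
  coassoc := by
    ext m
    simp only [LinearMap.comp_apply, LinearEquiv.coe_coe]
    rw [← LinearEquiv.eq_symm_apply]
    refine eq_of_contract fun g => eq_of_contract fun f => ?_
    rw [contract_rTensor, ← mul (.toConv f) (.toConv g)]
    induction ρ m using TensorProduct.induction_on with
    | zero => simp
    | add x y hx hy => simp only [map_add, hx, hy]
    | tmul x c =>
      simp only [LinearMap.lTensor_tmul, contract_tmul, LinearMap.convMul_def,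
        LinearMap.comp_apply]
      induction Coalgebra.comul (R := K) c using TensorProduct.induction_on with
      | zero => simp
      | add x y hx hy => simp only [map_add, hx, hy, TensorProduct.tmul_add, add_smul]
      | tmul c d => simp [smul_smul, mul_comm]
  counit_coact := by
    ext m
    apply (TensorProduct.rid K M).injective
    simpa [contract] using one m

variable {N : Type u} [AddCommGroup N] [Module K N] [RightComodule K C N] [RightComodule K C M]

theorem smul_def (f : DualAlgebra K C) (m : M) :
    f • m = contract K C M f.ofConv (coact m) := rfl

theorem isHom_iff {φ : M →ₗ[K] N} :
    IsHom K C φ ↔ ∀ (f : DualAlgebra K C) (m : M), φ (f • m) = f • φ m := by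
  constructor
  · intro h f m
    have := LinearMap.congr_fun h m
    simp only [LinearMap.comp_apply] at this
    rw [smul_def, smul_def, this, contract_rTensor]
  · intro h
    ext m
    refine eq_of_contract fun f => ?_
    rw [LinearMap.comp_apply, LinearMap.comp_apply, contract_rTensor]
    exact (h (.toConv f) m).symm

theorem IsSubcomodule.smul_mem {U : Submodule K M} (hU : IsSubcomodule K C U)
    (f : DualAlgebra K C) {x : M} (hx : x ∈ U) : f • x ∈ U := by
  obtain ⟨t, ht⟩ := hU x hx
  rw [smul_def, ← ht, contract_rTensor]
  exact Subtype.prop _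

/-- The action of `g` on `C` is the transpose of right multiplication by `g` on `C^*`. -/
theorem apply_smul_self (f g : DualAlgebra K C) (c : C) :
    f.ofConv (g • c) = (f * g).ofConv c := by
  have : ∀ t : C ⊗[K] C, f.ofConv (contract K C C g.ofConv t) =
      LinearMap.mul' K K (TensorProduct.map f.ofConv g.ofConv t) := by
    intro t
    induction t using TensorProduct.induction_on with
    | zero => simp
    | add x y hx hy => simp only [map_add, hx, hy]
    | tmul x c => simp [mul_comm]
  exact this _

/-- The comodule morphism `M → C`, `m ↦ η(m₀) m₁`, given by a functional `η` on `M`. -/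
noncomputable def toSelf (η : M →ₗ[K] K) : M →ₗ[K] C :=
  (TensorProduct.lid K C).toLinearMap ∘ₗ η.rTensor C ∘ₗ coact

theorem apply_toSelf (f : DualAlgebra K C) (η : M →ₗ[K] K) (m : M) :
    f.ofConv (toSelf η m) = η (f • m) := by
  rw [smul_def, toSelf]
  simp only [ LinearMap.comp_apply, LinearEquiv.coe_coe]
  induction coact (K := K) (C := C) m using TensorProduct.induction_on with
  | zero => simp
  | add x y hx hy => simp only [map_add, hx, hy]
  | tmul x c => simp [mul_comm]

theorem isHom_toSelf (η : M →ₗ[K] K) : IsHom K C (toSelf η : M →ₗ[K] C) := by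
  refine isHom_iff.2 fun f m => ext_dual (K := K) fun g => ?_
  obtain ⟨g, rfl⟩ := WithConv.ofConv_surjective g
  rw [apply_toSelf, apply_smul_self, apply_toSelf, mul_smul]

variable (K C) in
theorem counit_eq_one : (.toConv Coalgebra.counit : DualAlgebra K C) = 1 := by
  ext c; simp [LinearMap.convOne_def]

theorem counit_smul (m : M) : (.toConv Coalgebra.counit : DualAlgebra K C) • m = m := by
  rw [counit_eq_one, one_smul]

/-- Together with `isHom_toSelf` this makes `C` cofree: morphisms to `C` correspond to functionals,
by composition with the counit. -/
theorem IsHom.eq_toSelf {φ : M →ₗ[K] C} (h : IsHom K C φ) :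
    φ = toSelf (Coalgebra.counit ∘ₗ φ) := by
  ext m
  refine ext_dual (K := K) fun f => ?_
  obtain ⟨f, rfl⟩ := WithConv.ofConv_surjective f
  rw [apply_toSelf, LinearMap.comp_apply, isHom_iff.1 h]
  have := apply_smul_self (.toConv Coalgebra.counit) f (φ m)
  rw [counit_eq_one, one_mul] at this
  rw [← this, ← counit_eq_one]

theorem toSelf_comp {φ : M →ₗ[K] N} (h : IsHom K C φ) (η : N →ₗ[K] K) :
    toSelf η ∘ₗ φ = (toSelf (η ∘ₗ φ) : M →ₗ[K] C) := by
  ext m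
  refine ext_dual (K := K) fun f => ?_
  obtain ⟨f, rfl⟩ := WithConv.ofConv_surjective f
  rw [LinearMap.comp_apply, apply_toSelf, apply_toSelf, LinearMap.comp_apply, isHom_iff.1 h]

variable (K C) in
-- By cofreeness, extending a morphism to `C` amounts to extending a functional over a field.
theorem isInjective_self : IsInjective K C C := by
  intro X Y _ _ _ _ _ _ g φ hg hinj hφ
  obtain ⟨r, hr⟩ := g.exists_leftInverse_of_injective (LinearMap.ker_eq_bot.2 hinj)
  refine ⟨toSelf (Coalgebra.counit ∘ₗ φ ∘ₗ r), isHom_toSelf _, ?_⟩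
  rw [toSelf_comp hg, LinearMap.comp_assoc, LinearMap.comp_assoc, hr, LinearMap.comp_id,
    ← hφ.eq_toSelf]

theorem IsInjective.of_retract (hN : IsInjective K C N) {s : M →ₗ[K] N} {p : N →ₗ[K] M}
    (hs : IsHom K C s) (hp : IsHom K C p) (hps : p ∘ₗ s = LinearMap.id) :
    IsInjective K C M := by
  intro X Y _ _ _ _ _ _ g φ hg hinj hφ
  rw [isHom_iff] at hs hp hφ
  obtain ⟨ψ, hψ, h⟩ := hN X Y g (s ∘ₗ φ) hg hinj (isHom_iff.2 fun f m => by simp [hφ, hs])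
  rw [isHom_iff] at hψ
  refine ⟨p ∘ₗ ψ, isHom_iff.2 fun f m => by simp [hψ, hp], ?_⟩
  rw [LinearMap.comp_assoc, h, ← LinearMap.comp_assoc, hps, LinearMap.id_comp]

/-- A `C^*`-stable subspace of a right comodule, as a right comodule. -/
@[reducible] noncomputable def ofSubmodule (U : Submodule K M)
    (hU : ∀ (f : DualAlgebra K C), ∀ x ∈ U, f • x ∈ U) : RightComodule K C U :=
  let π := Classical.choose (U.subtype.exists_leftInverse_of_injective U.ker_subtype)
  have hπ : ∀ x (hx : x ∈ U), π x = ⟨x, hx⟩ := fun x hx => LinearMap.congr_fun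
    (Classical.choose_spec (U.subtype.exists_leftInverse_of_injective U.ker_subtype)) ⟨x, hx⟩
  have key : ∀ (f : DualAlgebra K C) (x : U), contract K C U f.ofConv
      ((π.rTensor C ∘ₗ coact ∘ₗ U.subtype) x) = ⟨f • (x : M), hU f x x.2⟩ := fun f x => by
    rw [LinearMap.comp_apply, contract_rTensor, ← hπ]; rfl
  ofContract (π.rTensor C ∘ₗ coact ∘ₗ U.subtype)
    (fun m => by
      rw [show (Coalgebra.counit : C →ₗ[K] K) = (.toConv Coalgebra.counit :
        DualAlgebra K C).ofConv from rfl, key]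
      exact Subtype.ext (counit_smul _))
    (fun f g m => by rw [key, key, key]; exact Subtype.ext (mul_smul _ _ _))

/-- The coaction on `U` is built from a chosen linear retraction; the resulting action does not
depend on it. -/
theorem coe_smul_ofSubmodule (U : Submodule K M)
    (hU : ∀ (f : DualAlgebra K C), ∀ x ∈ U, f • x ∈ U) (f : DualAlgebra K C) (x : U) :
    letI := ofSubmodule U hU
    ((f • x : U) : M) = f • (x : M) := by
  let π := Classical.choose (U.subtype.exists_leftInverse_of_injective U.ker_subtype)
  have hπ : ∀ x (hx : x ∈ U), π x = ⟨x, hx⟩ := fun x hx => LinearMap.congr_fun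
    (Classical.choose_spec (U.subtype.exists_leftInverse_of_injective U.ker_subtype)) ⟨x, hx⟩
  change ((contract K C U f.ofConv (π.rTensor C (coact (x : M))) : U) : M) = _
  rw [contract_rTensor, ← smul_def, hπ _ (hU f x x.2)]

end

end RightComodule

/-! ### Left comodules through the action of the dual algebra -/

namespace LeftComodule

section

variable {K C : Type u} [Field K] [AddCommGroup C] [Module K C]
variable {M : Type u} [AddCommGroup M] [Module K M]

@[simp]
theorem contract_tmul (f : C →ₗ[K] K) (m : M) (c : C) :
    contract K C M f (c ⊗ₜ[K] m) = f c • m := by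
  simp [contract]

theorem eq_of_contract {t t' : C ⊗[K] M}
    (h : ∀ f : C →ₗ[K] K, contract K C M f t = contract K C M f t') : t = t' := by
  apply (TensorProduct.comm K C M).injective
  refine RightComodule.eq_of_contract fun f => ?_
  have key : ∀ u : C ⊗[K] M, RightComodule.contract K C M f (TensorProduct.comm K C M u) =
      contract K C M f u := by
    intro u
    induction u using TensorProduct.induction_on with
    | zero => simp
    | tmul m c => simp
    | add x y hx hy => simp [hx, hy]
  rw [key, key, h]

theorem contract_lTensor {N : Type u} [AddCommGroup N] [Module K N] (φ : M →ₗ[K] N)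
    (f : C →ₗ[K] K) (t : C ⊗[K] M) :
    contract K C N f (φ.lTensor C t) = φ (contract K C M f t) := by
  induction t using TensorProduct.induction_on with
  | zero => simp
  | tmul m c => simp
  | add x y hx hy => simp [hx, hy]

end

section

variable {K C : Type u} [Field K] [AddCommGroup C] [Module K C] [Coalgebra K C]
variable {M : Type u} [AddCommGroup M] [Module K M]

/-- A map `l : M → C ⊗ M` whose contractions define a right action of `C^*` is a coaction. -/
@[reducible] def ofContract (l : M →ₗ[K] C ⊗[K] M)
    (one : ∀ m, contract K C M Coalgebra.counit (l m) = m)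
    (mul : ∀ (f g : DualAlgebra K C) (m : M), contract K C M (f * g).ofConv (l m) =
      contract K C M g.ofConv (l (contract K C M f.ofConv (l m)))) : LeftComodule K C M where
  coact := l
  coassoc := by
    ext m
    simp only [LinearMap.comp_apply, LinearEquiv.coe_coe]
    refine eq_of_contract fun f => eq_of_contract fun g => ?_
    rw [contract_lTensor, ← mul (.toConv f) (.toConv g)]
    induction l m using TensorProduct.induction_on with
    | zero => simp
    | add x y hx hy => simp only [map_add, hx, hy]
    | tmul c x =>
      simp only [LinearMap.rTensor_tmul, contract_tmul, LinearMap.convMul_def,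
        LinearMap.comp_apply]
      induction Coalgebra.comul (R := K) c using TensorProduct.induction_on with
      | zero => simp
      | add x y hx hy => simp only [map_add, hx, hy, TensorProduct.add_tmul, add_smul]
      | tmul c d => simp [smul_smul]
  counit_coact := by
    ext m
    apply (TensorProduct.lid K M).injective
    simpa [contract] using one m

variable {N : Type u} [AddCommGroup N] [Module K N] [LeftComodule K C N] [LeftComodule K C M]

theorem smul_def (f : (DualAlgebra K C)ᵐᵒᵖ) (m : M) :
    f • m = contract K C M f.unop.ofConv (coact m) := rfl

instance : SMulCommClass (DualAlgebra K C)ᵐᵒᵖ K M where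
  smul_comm f k m := by simp [smul_def]

instance : IsScalarTower K (DualAlgebra K C)ᵐᵒᵖ M where
  smul_assoc k f m := by simp [smul_def, contract, LinearMap.rTensor_smul]

theorem isHom_iff {φ : M →ₗ[K] N} :
    IsHom K C φ ↔ ∀ (f : (DualAlgebra K C)ᵐᵒᵖ) (m : M), φ (f • m) = f • φ m := by
  constructor
  · intro h f m
    have := LinearMap.congr_fun h m
    simp only [LinearMap.comp_apply] at this
    rw [smul_def, smul_def, this, contract_lTensor]
  · intro h
    ext m
    refine eq_of_contract fun f => ?_
    rw [LinearMap.comp_apply, LinearMap.comp_apply, contract_lTensor]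
    exact (h (.op (.toConv f)) m).symm

theorem isSubcomodule_of_smul_mem {U : Submodule K M}
    (hU : ∀ f : (DualAlgebra K C)ᵐᵒᵖ, ∀ x ∈ U, f • x ∈ U) : IsSubcomodule K C U := by
  obtain ⟨π, hπ⟩ := U.subtype.exists_leftInverse_of_injective U.ker_subtype
  intro x hx
  refine ⟨π.lTensor C (coact x), eq_of_contract fun f => ?_⟩
  rw [contract_lTensor, contract_lTensor]
  exact congrArg Subtype.val (LinearMap.congr_fun hπ ⟨_, hU (.op (.toConv f)) x hx⟩)

/-- `C` as a left comodule over itself. -/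
instance self : LeftComodule K C C where
  coact := Coalgebra.comul
  coassoc := Coalgebra.coassoc
  counit_coact := Coalgebra.rTensor_counit_comp_comul

theorem apply_smul_self (f g : DualAlgebra K C) (c : C) :
    g.ofConv (MulOpposite.op f • c) = (f * g).ofConv c := by
  have : ∀ t : C ⊗[K] C, g.ofConv (contract K C C f.ofConv t) =
      LinearMap.mul' K K (TensorProduct.map f.ofConv g.ofConv t) := by
    intro t
    induction t using TensorProduct.induction_on with
    | zero => simp
    | add x y hx hy => simp only [map_add, hx, hy]
    | tmul x c => simp
  exact this _

/-- The comodule morphism `M → C`, `m ↦ m₋₁ η(m₀)`, given by a functional `η` on `M`. -/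
noncomputable def toSelf (η : M →ₗ[K] K) : M →ₗ[K] C :=
  (TensorProduct.rid K C).toLinearMap ∘ₗ η.lTensor C ∘ₗ coact

theorem apply_toSelf (f : DualAlgebra K C) (η : M →ₗ[K] K) (m : M) :
    f.ofConv (toSelf η m) = η (MulOpposite.op f • m) := by
  rw [smul_def, toSelf]
  simp only [ LinearMap.comp_apply, LinearEquiv.coe_coe]
  induction coact (K := K) (C := C) m using TensorProduct.induction_on with
  | zero => simp
  | add x y hx hy => simp only [map_add, hx, hy]
  | tmul x c => simp [mul_comm]

theorem isHom_toSelf (η : M →ₗ[K] K) : IsHom K C (toSelf η : M →ₗ[K] C) := by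
  refine isHom_iff.2 fun f m => RightComodule.ext_dual (K := K) fun g => ?_
  obtain ⟨g, rfl⟩ := WithConv.ofConv_surjective g
  obtain ⟨f, rfl⟩ := MulOpposite.op_surjective f
  rw [apply_toSelf, apply_smul_self, apply_toSelf, MulOpposite.op_mul, mul_smul]

theorem counit_smul (m : M) :
    MulOpposite.op (.toConv Coalgebra.counit : DualAlgebra K C) • m = m := by
  rw [RightComodule.counit_eq_one, MulOpposite.op_one, one_smul]

/-- A `C^*`-stable subspace of a left comodule, as a left comodule. -/
@[reducible] noncomputable def ofSubmodule (U : Submodule K M)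
    (hU : ∀ (f : (DualAlgebra K C)ᵐᵒᵖ), ∀ x ∈ U, f • x ∈ U) : LeftComodule K C U :=
  let π := Classical.choose (U.subtype.exists_leftInverse_of_injective U.ker_subtype)
  have hπ : ∀ x (hx : x ∈ U), π x = ⟨x, hx⟩ := fun x hx => LinearMap.congr_fun
    (Classical.choose_spec (U.subtype.exists_leftInverse_of_injective U.ker_subtype)) ⟨x, hx⟩
  have key : ∀ (f : DualAlgebra K C) (x : U), contract K C U f.ofConv
      ((π.lTensor C ∘ₗ coact ∘ₗ U.subtype) x) =
        ⟨MulOpposite.op f • (x : M), hU _ x x.2⟩ := fun f x => by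
    rw [LinearMap.comp_apply, contract_lTensor, ← hπ]; rfl
  ofContract (π.lTensor C ∘ₗ coact ∘ₗ U.subtype)
    (fun m => by
      rw [show (Coalgebra.counit : C →ₗ[K] K) = (.toConv Coalgebra.counit :
        DualAlgebra K C).ofConv from rfl, key]
      exact Subtype.ext (counit_smul _))
    (fun f g m => by rw [key, key, key]; exact Subtype.ext (mul_smul _ _ _))

theorem coe_smul_ofSubmodule (U : Submodule K M)
    (hU : ∀ (f : (DualAlgebra K C)ᵐᵒᵖ), ∀ x ∈ U, f • x ∈ U) (f : (DualAlgebra K C)ᵐᵒᵖ) (x : U) :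
    letI := ofSubmodule U hU
    ((f • x : U) : M) = f • (x : M) := by
  let π := Classical.choose (U.subtype.exists_leftInverse_of_injective U.ker_subtype)
  have hπ : ∀ x (hx : x ∈ U), π x = ⟨x, hx⟩ := fun x hx => LinearMap.congr_fun
    (Classical.choose_spec (U.subtype.exists_leftInverse_of_injective U.ker_subtype)) ⟨x, hx⟩
  change ((contract K C U f.unop.ofConv (π.lTensor C (coact (x : M))) : U) : M) = _
  rw [contract_lTensor, ← smul_def, hπ _ (hU f x x.2)]

/-! ### Duals of finite-dimensional comodules, and local finiteness -/

variable (K C M) in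
/-- The map `M^* → M^* ⊗ C` corresponding to `μ ↦ (m ↦ m₋₁ μ(m₀))`, for `M` finite dimensional. -/
noncomputable def dualCoact [FiniteDimensional K M] :
    Module.Dual K M →ₗ[K] Module.Dual K M ⊗[K] C :=
  (dualTensorHomEquiv K M C).symm.toLinearMap ∘ₗ
    LinearMap.mk₂ K (fun η m => toSelf η m)
      (fun _ _ _ => by simp [toSelf, LinearMap.lTensor_add])
      (fun _ _ _ => by simp [toSelf, LinearMap.lTensor_smul])
      (fun _ _ _ => map_add _ _ _) (fun _ _ _ => map_smul _ _ _)

theorem contract_dualCoact [FiniteDimensional K M] (f : DualAlgebra K C) (μ : Module.Dual K M)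
    (m : M) : RightComodule.contract K C (Module.Dual K M) f.ofConv (dualCoact K C M μ) m =
      μ (MulOpposite.op f • m) := by
  have : ∀ t : Module.Dual K M ⊗[K] C, RightComodule.contract K C _ f.ofConv t m =
      f.ofConv (dualTensorHomEquiv K M C t m) := by
    intro t
    induction t using TensorProduct.induction_on with
    | zero => simp
    | add x y hx hy => simp only [map_add, LinearMap.add_apply, hx, hy]
    | tmul x c => simp [mul_comm]
  rw [this, ← apply_toSelf]
  simp only [dualCoact, LinearMap.comp_apply, LinearEquiv.coe_coe, LinearEquiv.apply_symm_apply]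
  rfl

/-- The dual of a finite-dimensional left comodule is a right comodule. -/
noncomputable instance dual [FiniteDimensional K M] : RightComodule K C (Module.Dual K M) :=
  RightComodule.ofContract (dualCoact K C M)
    (fun μ => LinearMap.ext fun m => by
      rw [show (Coalgebra.counit : C →ₗ[K] K) = (.toConv Coalgebra.counit :
        DualAlgebra K C).ofConv from rfl, contract_dualCoact, counit_smul])
    (fun f g μ => LinearMap.ext fun m => by
      rw [contract_dualCoact, contract_dualCoact, contract_dualCoact, MulOpposite.op_mul,
        mul_smul])

theorem dual_smul_apply [FiniteDimensional K M] (f : DualAlgebra K C) (μ : Module.Dual K M)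
    (m : M) : (f • μ) m = μ (MulOpposite.op f • m) :=
  contract_dualCoact f μ m

/-- The coaction of `x` is a finite sum of tensors `c ⊗ m`, and every `x · f` lies in the span of
these `m`. -/
theorem finiteDimensional_span_singleton (x : M) :
    FiniteDimensional K (Submodule.span (DualAlgebra K C)ᵐᵒᵖ {x}) := by
  have : ∀ t : C ⊗[K] M, ∃ U : Submodule K M, FiniteDimensional K U ∧
      ∀ f, contract K C M f t ∈ U := by
    intro t
    induction t using TensorProduct.induction_on with
    | zero => exact ⟨⊥, inferInstance, by simp⟩
    | tmul c m =>
      exact ⟨K ∙ m, inferInstance, fun f => by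
        simpa using Submodule.smul_mem _ _ (Submodule.mem_span_singleton_self m)⟩
    | add t t' h h' =>
      obtain ⟨U, hU, h⟩ := h
      obtain ⟨U', hU', h'⟩ := h'
      exact ⟨U ⊔ U', inferInstance, fun f => by
        rw [map_add]; exact Submodule.add_mem_sup (h f) (h' f)⟩
  obtain ⟨U, hU, h⟩ := this (coact x)
  refine Submodule.finiteDimensional_of_le
    (S₁ := (Submodule.span (DualAlgebra K C)ᵐᵒᵖ {x}).restrictScalars K) (S₂ := U) fun y hy => ?_
  obtain ⟨f, rfl⟩ := Submodule.mem_span_singleton.1 hy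
  exact h _

end

end LeftComodule

/-! ## Semisimple modules and finite Loewy length -/

section

theorem isSemisimpleModule_prod {R M N : Type*} [Ring R] [AddCommGroup M] [Module R M]
    [AddCommGroup N] [Module R N] [IsSemisimpleModule R M] [IsSemisimpleModule R N] :
    IsSemisimpleModule R (M × N) := by
  refine isSemisimpleModule_of_isSemisimpleModule_submodule'
    (p := fun b : Bool => cond b (LinearMap.range (LinearMap.inl R M N))
      (LinearMap.range (LinearMap.inr R M N))) ?_ ?_
  · rintro (_ | _)
    · exact IsSemisimpleModule.range _
    · exact IsSemisimpleModule.range _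
  · rw [iSup_bool_eq]
    exact LinearMap.sup_range_inl_inr

/-- Let `N` be a cyclic semisimple module with generator `v`, and let `W` be a nonzero module which
is not simple and such that every element of `W` is the image of `v` under a morphism. An additive
subgroup of `R` containing all `a` for which no `a • w` generates `W` contains `1`. -/
theorem AddSubgroup.one_mem_of_forall_exists_linearMap {R N W : Type*} [Ring R]
    [AddCommGroup N] [Module R N] [IsSemisimpleModule R N] [AddCommGroup W] [Module R W]
    [Nontrivial W] (hW : ¬ IsSimpleModule R W) {v : N} (hv : ∀ x : N, ∃ f : R, f • v = x)
    (eval : ∀ w : W, ∃ L : N →ₗ[R] W, L v = w) (B : AddSubgroup R)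
    (hB : ∀ a, (∀ w : W, Submodule.span R {a • w} ≠ ⊤) → a ∈ B) : 1 ∈ B := by
  -- An `a` that kills `v` kills all of `W`, every element of which is an image of `v`.
  have hzero : ∀ a : R, a • v = 0 → a ∈ B := by
    intro a ha
    refine hB a fun w => ?_
    obtain ⟨L, rfl⟩ := eval w
    rw [← map_smul, ha, map_zero, Submodule.span_zero_singleton]
    exact bot_ne_top
  -- Decompose `a • v` into elements of simple submodules; the case `a = 1` is the goal.
  have main : ∀ u : N, ∀ a : R, a • v = u → a ∈ B := by
    intro u
    have hu : u ∈ sSup {m : Submodule R N | IsSimpleModule R m} := by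
      rw [IsSemisimpleModule.sSup_simples_eq_top]; trivial
    rw [sSup_eq_iSup'] at hu
    induction hu using Submodule.iSup_induction' with
    | zero => exact hzero
    | mem P x hx =>
      intro a ha
      -- If `a • w` generated `W`, the simple module `P` would map onto `W`, making `W` simple.
      refine hB a fun w hw => hW ?_
      obtain ⟨L, rfl⟩ := eval w
      obtain ⟨P, hP⟩ := P
      have : IsSimpleModule R P := hP
      let g : P →ₗ[R] W := L ∘ₗ P.subtype
      have hg : Function.Surjective g := by
        rw [← LinearMap.range_eq_top, eq_top_iff, ← hw, Submodule.span_singleton_le_iff_mem]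
        refine ⟨⟨x, hx⟩, ?_⟩
        rw [← map_smul, ha]
        rfl
      refine IsSimpleModule.congr (LinearEquiv.ofBijective g ⟨?_, hg⟩).symm
      refine (LinearMap.injective_or_eq_zero g).resolve_right fun h => ?_
      obtain ⟨w, hw0⟩ := exists_ne (0 : W)
      obtain ⟨p, rfl⟩ := hg w
      exact hw0 (by rw [h]; rfl)
    | add x y _ _ hx hy =>
      intro a ha
      obtain ⟨f, hf⟩ := hv x
      obtain ⟨g, hg⟩ := hv y
      have h := hzero (a - (f + g)) (by rw [sub_smul, add_smul, ha, hf, hg, sub_self])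
      have := B.add_mem h (B.add_mem (hx f hf) (hy g hg))
      rwa [sub_add_cancel] at this
  exact main v 1 (one_smul _ _)

/-- If `W` is a finite-dimensional semisimple module which is not simple, then an additive subgroup
of `R` containing all `a` for which no `a • w` generates `W` contains `1`. -/
theorem AddSubgroup.one_mem_of_isSemisimpleModule (K : Type*) {R W : Type*} [Field K] [Ring R]
    [AddCommGroup W] [Module K W] [Module R W] [SMulCommClass R K W] [FiniteDimensional K W]
    [IsSemisimpleModule R W] [Nontrivial W] (hW : ¬ IsSimpleModule R W) (B : AddSubgroup R)
    (hB : ∀ a, (∀ w : W, Submodule.span R {a • w} ≠ ⊤) → a ∈ B) : 1 ∈ B := by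
  let b := Module.finBasis K W
  let v : Fin (Module.finrank K W) → W := b
  -- A basis of `W`, viewed as one element of a finite power of `W`, maps to any `w` by a
  -- combination of the projections with coefficients in `K`.
  refine AddSubgroup.one_mem_of_forall_exists_linearMap hW (N := Submodule.span R {v})
    (v := ⟨v, Submodule.mem_span_singleton_self v⟩) ?_ ?_ B hB
  · rintro ⟨x, hx⟩
    obtain ⟨f, rfl⟩ := Submodule.mem_span_singleton.1 hx
    exact ⟨f, rfl⟩
  · intro w
    refine ⟨(∑ i, (b.repr w i) • LinearMap.proj i) ∘ₗ (Submodule.span R {v}).subtype, ?_⟩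
    simp only [LinearMap.comp_apply, LinearMap.sum_apply, LinearMap.smul_apply,
      LinearMap.proj_apply]
    exact b.sum_repr w

/-- If `n` is the last index with `N + Lₙ ≠ M`, the socle layer `Lₙ₊₁ / Lₙ` maps onto `M / (N +
Lₙ)`. This quotient is thus nonzero and semisimple, and has a maximal submodule. -/
theorem HasFiniteLoewyLength.exists_isCoatom {R M : Type u} [Ring R] [AddCommGroup M] [Module R M]
    (h : HasFiniteLoewyLength R M) {N : Submodule R M} (hN : N ≠ ⊤) :
    ∃ V : Submodule R M, IsCoatom V ∧ N ≤ V := by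
  classical
  have hex : ∃ n, N ⊔ loewySeries R M n = ⊤ := by
    obtain ⟨n, hn⟩ := h
    exact ⟨n, by rw [hn, sup_top_eq]⟩
  obtain ⟨n, hn, hlt⟩ : ∃ n, N ⊔ loewySeries R M (n + 1) = ⊤ ∧ N ⊔ loewySeries R M n ≠ ⊤ := by
    have h0 : Nat.find hex ≠ 0 := fun h0 => hN (by
      have := Nat.find_spec hex
      rw [h0] at this
      simpa [loewySeries] using this)
    obtain ⟨n, hn⟩ := Nat.exists_eq_succ_of_ne_zero h0
    have := Nat.find_spec hex
    rw [hn] at this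
    exact ⟨n, this, Nat.find_min hex (by omega)⟩
  set L := loewySeries R M n
  set N' := N ⊔ L with hN'
  let g : M ⧸ L →ₗ[R] M ⧸ N' := Submodule.factor le_sup_right
  have : IsSemisimpleModule R (moduleSocle R (M ⧸ L)) := by
    have := isSemisimpleModule_biSup_of_isSemisimpleModule_submodule
      (s := {m : Submodule R (M ⧸ L) | IsSimpleModule R m}) (p := id)
      (fun m hm => by have : IsSimpleModule R m := hm; exact inferInstanceAs (IsSemisimpleModule R m))
    rwa [moduleSocle, sSup_eq_iSup]
  have hss : IsSemisimpleModule R (M ⧸ N') := by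
    refine IsSemisimpleModule.of_surjective (g ∘ₗ (moduleSocle R (M ⧸ L)).subtype) fun q => ?_
    obtain ⟨x, rfl⟩ := N'.mkQ_surjective q
    obtain ⟨y, hy, z, hz, rfl⟩ := Submodule.mem_sup.1 (hn ▸ Submodule.mem_top (x := x))
    refine ⟨⟨L.mkQ z, hz⟩, ?_⟩
    have : N'.mkQ y = 0 := by
      simpa using (le_sup_left : N ≤ N') hy
    rw [map_add, this, zero_add]
    rfl
  have : Nontrivial (M ⧸ N') := Submodule.Quotient.nontrivial_iff.2 hlt
  obtain ⟨V, hV⟩ := IsCoatomic.exists_coatom (Submodule R (M ⧸ N'))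
  refine ⟨V.comap N'.mkQ, ?_, ?_⟩
  · exact (Submodule.isCoatom_comap_iff N'.mkQ_surjective).2 hV
  · intro x hx
    have : N'.mkQ x = 0 := by simpa using (le_sup_left : N ≤ N') hx
    rw [Submodule.mem_comap, this]
    exact V.zero_mem

end

/-! ### Cyclic submodules and uniqueness of the maximal submodule -/

namespace LeftComodule

variable {K C : Type u} [Field K] [AddCommGroup C] [Module K C] [Coalgebra K C]
variable {E : Type u} [AddCommGroup E] [Module K E] [LeftComodule K C E]

/-- Let `E` be an injective left comodule in which every nonzero submodule contains `s ≠ 0`. A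
finite-dimensional subcomodule `X` of `E` containing `s`, with a comodule morphism `φ : C → X^*`
not killing `s` on `C · a`, is contained in the submodule generated by some `y · a`. -/
theorem exists_smul_eq {X : Type u} [AddCommGroup X] [Module K X] [LeftComodule K C X]
    [FiniteDimensional K X] (hE : IsInjective K C E) {s : E} (hs : s ≠ 0)
    (hess : ∀ U : Submodule (DualAlgebra K C)ᵐᵒᵖ E, U ≠ ⊥ → s ∈ U)
    {ι : X →ₗ[K] E} (hι : IsHom K C ι) (hinj : Function.Injective ι) {t : X} (ht : ι t = s)
    {φ : C →ₗ[K] Module.Dual K X} (hφ : RightComodule.IsHom K C φ) (a : (DualAlgebra K C)ᵐᵒᵖ)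
    (ha : ∃ c, φ (a • c) t ≠ 0) :
    ∃ y : E, ∀ x, ι x = MulOpposite.op (.toConv (φ.flip x) : DualAlgebra K C) • a • y := by
  obtain ⟨a, rfl⟩ := MulOpposite.op_surjective a
  rw [isHom_iff] at hι
  rw [RightComodule.isHom_iff] at hφ
  have hflip : ∀ (f : DualAlgebra K C) (x : X),
      (.toConv (φ.flip (MulOpposite.op f • x)) : DualAlgebra K C) = .toConv (φ.flip x) * f := by
    intro f x
    ext c
    rw [← RightComodule.apply_smul_self]
    simp [hφ, dual_smul_apply]
  -- The embedding of `X` in `C^*` followed by left multiplication by `a`, which respects the right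
  -- action.
  let L : X →ₗ[K] C →ₗ[K] K :=
    { toFun x := (a * .toConv (φ.flip x)).ofConv
      map_add' x y := by rw [map_add, WithConv.toConv_add, mul_add]; rfl
      map_smul' k x := by rw [map_smul, WithConv.toConv_smul, mul_smul_comm]; rfl }
  have hL : ∀ (f : DualAlgebra K C) (x : X),
      L (MulOpposite.op f • x) = (.toConv (L x) * f : DualAlgebra K C).ofConv := by
    intro f x
    change (a * .toConv (φ.flip (MulOpposite.op f • x)) : DualAlgebra K C).ofConv = _
    rw [hflip, ← mul_assoc]
    rfl
  have hLinj : Function.Injective L := by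
    rw [injective_iff_map_eq_zero]
    intro x hx
    let Z : Submodule (DualAlgebra K C)ᵐᵒᵖ E :=
      { carrier := ι '' {x | L x = 0}
        zero_mem' := ⟨0, map_zero L, map_zero ι⟩
        add_mem' := by
          rintro _ _ ⟨x, hx, rfl⟩ ⟨y, hy, rfl⟩
          exact ⟨x + y, by simp_all, map_add _ _ _⟩
        smul_mem' := by
          rintro f _ ⟨x, hx, rfl⟩
          obtain ⟨f, rfl⟩ := MulOpposite.op_surjective f
          refine ⟨MulOpposite.op f • x, ?_, hι _ _⟩
          rw [Set.mem_ofPred_eq] at hx ⊢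
          rw [hL, hx, WithConv.toConv_zero, zero_mul, WithConv.ofConv_zero] }
    -- A nonzero kernel would contain `s`, contradicting `ha`.
    by_contra hx0
    obtain ⟨t', ht', hs'⟩ := hess Z fun hZ => hx0 <| by
      have : ι x ∈ Z := ⟨x, hx, rfl⟩
      rw [hZ, Submodule.mem_bot] at this
      exact hinj (this.trans (map_zero ι).symm)
    obtain rfl : t' = t := hinj (hs'.trans ht.symm)
    obtain ⟨c, hc⟩ := ha
    apply hc
    rw [Set.mem_ofPred_eq] at ht'
    rw [← LinearMap.flip_apply, ← WithConv.ofConv_toConv (φ.flip t'), apply_smul_self]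
    exact LinearMap.congr_fun ht' c
  obtain ⟨ξ, hξ⟩ : ∃ ξ : Module.Dual K E, ξ s ≠ 0 := by
    by_contra! h
    exact hs ((Module.forall_dual_apply_eq_zero_iff K s).1 h)
  let j : E →ₗ[K] C := toSelf ξ
  have hj : IsHom K C j := isHom_toSelf ξ
  have hj' := isHom_iff.1 hj
  have hjinj : Function.Injective j := by
    rw [injective_iff_map_eq_zero]
    intro x hx
    let Z : Submodule (DualAlgebra K C)ᵐᵒᵖ E :=
      { carrier := {x | j x = 0}
        zero_mem' := map_zero j
        add_mem' := fun {x y} hx hy => by simp_all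
        smul_mem' := fun f x hx => by
          rw [Set.mem_ofPred_eq] at hx ⊢
          rw [hj', hx, smul_zero] }
    by_contra hx0
    have hsZ : j s = 0 := hess Z fun hZ => hx0 <| by
      have : x ∈ Z := hx
      rwa [hZ, Submodule.mem_bot] at this
    apply hξ
    have := apply_toSelf (.toConv Coalgebra.counit : DualAlgebra K C) ξ s
    rw [counit_smul] at this
    rw [← this]
    exact (congrArg _ hsZ).trans (map_zero _)
  obtain ⟨r, hr, hrj⟩ := hE E C j LinearMap.id hj hjinj (isHom_iff.2 fun _ _ => rfl)
  rw [isHom_iff] at hr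
  -- As `X` is finite dimensional and `L` is injective, every functional on `X` is evaluation of `L`
  -- at some point of `C`.
  obtain ⟨c, hc⟩ := LinearMap.flip_surjective_iff₁.2 hLinj (ξ ∘ₗ ι)
  refine ⟨r c, fun x => ?_⟩
  -- Applying `f` to either side gives `ξ (ι x · f)`.
  have key : j (ι x) = MulOpposite.op (.toConv (L x) : DualAlgebra K C) • c := by
    refine RightComodule.ext_dual (K := K) fun f => ?_
    obtain ⟨f, rfl⟩ := WithConv.ofConv_surjective f
    rw [apply_toSelf, ← hι, apply_smul_self, ← hL]
    exact (LinearMap.congr_fun hc _).symm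
  have h1 : r (j (ι x)) = ι x := LinearMap.congr_fun hrj _
  rw [← h1, key, hr, ← mul_smul, ← MulOpposite.op_mul]
  rfl

/-- Let `E` be an injective left comodule in which every nonzero submodule contains `s ≠ 0`, over a
coalgebra with the right generating condition. For every finite-dimensional submodule `X ≠ 0` of
`E`, those `a` for which no `y · a` generates a submodule containing `X` lie in a proper
additive subgroup of `C^*`. -/
theorem exists_addSubgroup (hC : RightComodule.GeneratingCondition K C)
    (hE : IsInjective K C E) {s : E} (hs : s ≠ 0)
    (hess : ∀ U : Submodule (DualAlgebra K C)ᵐᵒᵖ E, U ≠ ⊥ → s ∈ U)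
    (X : Submodule (DualAlgebra K C)ᵐᵒᵖ E) [FiniteDimensional K X] (hX : X ≠ ⊥) :
    ∃ B : AddSubgroup (DualAlgebra K C)ᵐᵒᵖ, 1 ∉ B ∧
      ∀ a, a ∉ B → ∃ y : E, X ≤ Submodule.span (DualAlgebra K C)ᵐᵒᵖ {a • y} := by
  let U : Submodule K E := X.restrictScalars K
  have hU : ∀ f : (DualAlgebra K C)ᵐᵒᵖ, ∀ x ∈ U, f • x ∈ U := fun f x hx => X.smul_mem f hx
  let := ofSubmodule U hU
  have : FiniteDimensional K U := inferInstanceAs (FiniteDimensional K X)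
  let t : U := ⟨s, hess X hX⟩
  -- The `a` for which the hypothesis `ha` of `exists_smul_eq` fails for every `φ`; this condition
  -- is additive in `a`.
  refine ⟨{ carrier := {a | ∀ φ : C →ₗ[K] Module.Dual K U, RightComodule.IsHom K C φ →
              ∀ c : C, φ (a • c) t = 0}
            zero_mem' := fun φ _ c => by
              have h : (0 : (DualAlgebra K C)ᵐᵒᵖ) • c = 0 := zero_smul (DualAlgebra K C)ᵐᵒᵖ c
              exact (congrArg (fun d => φ d t) h).trans (by rw [map_zero, LinearMap.zero_apply])
            add_mem' := fun {a b} ha hb φ hφ c => by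
              rw [add_smul, map_add, LinearMap.add_apply, ha φ hφ, hb φ hφ, add_zero]
            neg_mem' := fun {a} ha φ hφ c => by
              rw [neg_smul, map_neg, LinearMap.neg_apply, ha φ hφ, neg_zero] }, ?_, ?_⟩
  · intro h1
    -- The images of `C` span the dual of `U`, so if all of them vanished at `t`, then `t` would be
    -- zero.
    have h : (⊤ : Submodule K (Module.Dual K U)) ≤ LinearMap.ker (Module.Dual.eval K U t) := by
      rw [← hC (Module.Dual K U), iSup_le_iff]
      rintro ⟨φ, hφ⟩ _ ⟨c, rfl⟩
      simpa using h1 φ hφ c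
    have ht : t = 0 := (Module.forall_dual_apply_eq_zero_iff K t).1
      fun μ => h (Submodule.mem_top (x := μ))
    exact hs (congrArg Subtype.val ht)
  · intro a ha
    obtain ⟨φ, hφ, c, hc⟩ : ∃ φ : C →ₗ[K] Module.Dual K U, RightComodule.IsHom K C φ ∧
        ∃ c : C, φ (a • c) t ≠ 0 := by
      by_contra! h
      exact ha h
    obtain ⟨y, hy⟩ := exists_smul_eq hE hs hess
      (isHom_iff.2 fun f x => coe_smul_ofSubmodule U hU f x) U.injective_subtype (t := t) rfl hφ a
      ⟨c, hc⟩
    exact ⟨y, fun x hx => Submodule.mem_span_singleton.2 ⟨_, (hy ⟨x, hx⟩).symm⟩⟩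

/-- For distinct `V` and `V'`, a finite-dimensional `X` maps onto the non-simple semisimple module
`E/V × E/V'`. Each `a` outside the proper subgroup `B` of `exists_addSubgroup` then has a multiple
generating that product, against `AddSubgroup.one_mem_of_isSemisimpleModule`. -/
theorem isCoatom_unique (hC : RightComodule.GeneratingCondition K C)
    (hE : IsInjective K C E) {s : E} (hs : s ≠ 0)
    (hess : ∀ U : Submodule (DualAlgebra K C)ᵐᵒᵖ E, U ≠ ⊥ → s ∈ U)
    {V V' : Submodule (DualAlgebra K C)ᵐᵒᵖ E} (hV : IsCoatom V) (hV' : IsCoatom V') :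
    V = V' := by
  by_contra hne
  obtain ⟨x, hxV', hxV⟩ := Set.not_subset.1
    (fun h : (V' : Set E) ⊆ V => hne (hV'.le_iff_eq hV.1 |>.1 h))
  obtain ⟨x', hx'V, hx'V'⟩ := Set.not_subset.1
    (fun h : (V : Set E) ⊆ V' => hne (hV.le_iff_eq hV'.1 |>.1 h).symm)
  have := finiteDimensional_span_singleton (K := K) (C := C) x
  have := finiteDimensional_span_singleton (K := K) (C := C) x'
  let X : Submodule (DualAlgebra K C)ᵐᵒᵖ E := Submodule.span _ {x} ⊔ Submodule.span _ {x'}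
  have hxX : x ∈ X := Submodule.mem_sup_left (Submodule.mem_span_singleton_self x)
  have hx'X : x' ∈ X := Submodule.mem_sup_right (Submodule.mem_span_singleton_self x')
  have hfin : FiniteDimensional K X := by
    have : X.restrictScalars K = (Submodule.span (DualAlgebra K C)ᵐᵒᵖ {x}).restrictScalars K ⊔
        (Submodule.span (DualAlgebra K C)ᵐᵒᵖ {x'}).restrictScalars K :=
      Submodule.restrictScalars_sup ..
    change FiniteDimensional K (X.restrictScalars K)
    rw [this]
    exact Submodule.finite_sup _ _ (h₁ := ‹_›) (h₂ := ‹_›)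
  have hX0 : X ≠ ⊥ := fun h => hxV (by
    rw [h, Submodule.mem_bot] at hxX
    rw [hxX]
    exact V.zero_mem)
  obtain ⟨B, hB1, hB⟩ := exists_addSubgroup hC hE hs hess X hX0
  have hS : IsSimpleModule _ (E ⧸ V) := isSimpleModule_iff_isCoatom.2 hV
  have hS' : IsSimpleModule _ (E ⧸ V') := isSimpleModule_iff_isCoatom.2 hV'
  have := IsSimpleModule.nontrivial (DualAlgebra K C)ᵐᵒᵖ (E ⧸ V)
  have := IsSimpleModule.nontrivial (DualAlgebra K C)ᵐᵒᵖ (E ⧸ V')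
  let π : E →ₗ[(DualAlgebra K C)ᵐᵒᵖ] (E ⧸ V) × (E ⧸ V') := V.mkQ.prod V'.mkQ
  have hπX : X.map π = ⊤ := by
    rw [eq_top_iff]
    rintro ⟨q, q'⟩ -
    obtain ⟨f, rfl⟩ := IsSimpleModule.toSpanSingleton_surjective (DualAlgebra K C)ᵐᵒᵖ
      (m := V.mkQ x) (by simpa using hxV) q
    obtain ⟨f', rfl⟩ := IsSimpleModule.toSpanSingleton_surjective (DualAlgebra K C)ᵐᵒᵖ
      (m := V'.mkQ x') (by simpa using hx'V') q'
    refine ⟨f • x + f' • x', X.add_mem (X.smul_mem _ hxX) (X.smul_mem _ hx'X), ?_⟩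
    have h1 : V.mkQ x' = 0 := by simpa using hx'V
    have h2 : V'.mkQ x = 0 := by simpa using hxV'
    refine Prod.ext ?_ ?_
    · change V.mkQ (f • x + f' • x') = f • V.mkQ x
      rw [map_add, map_smul, map_smul, h1, smul_zero, add_zero]
    · change V'.mkQ (f • x + f' • x') = f' • V'.mkQ x'
      rw [map_add, map_smul, map_smul, h2, smul_zero, zero_add]
  have : FiniteDimensional K (X.restrictScalars K) := hfin
  have : FiniteDimensional K ((E ⧸ V) × (E ⧸ V')) := by
    refine Module.Finite.of_surjective ((π.restrictScalars K).domRestrict (X.restrictScalars K))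
      fun q => ?_
    obtain ⟨x, hx, rfl⟩ := hπX ▸ Submodule.mem_top (x := q)
    exact ⟨⟨x, hx⟩, rfl⟩
  have : IsSemisimpleModule (DualAlgebra K C)ᵐᵒᵖ ((E ⧸ V) × (E ⧸ V')) :=
    isSemisimpleModule_prod
  refine hB1 (AddSubgroup.one_mem_of_isSemisimpleModule K (W := (E ⧸ V) × (E ⧸ V')) ?_ B ?_)
  -- By Schur's lemma the first projection would be injective or zero; it is neither.
  · intro h
    rcases LinearMap.injective_or_eq_zero
      (LinearMap.fst (DualAlgebra K C)ᵐᵒᵖ (E ⧸ V) (E ⧸ V')) with h | h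
    · obtain ⟨q, hq⟩ := exists_ne (0 : E ⧸ V')
      exact hq (congrArg Prod.snd (@h (0, q) (0, 0) rfl))
    · obtain ⟨q, hq⟩ := exists_ne (0 : E ⧸ V)
      exact hq (LinearMap.congr_fun h (q, 0))
  · intro a ha
    by_contra haB
    obtain ⟨y, hy⟩ := hB a haB
    apply ha (π y)
    rw [eq_top_iff, ← hπX, ← map_smul, ← Set.image_singleton, ← Submodule.map_span]
    exact Submodule.map_mono hy

end LeftComodule

/-! ### Injectivity and simple socle of the dual -/

namespace LeftComodule

variable {K C : Type u} [Field K] [AddCommGroup C] [Module K C] [Coalgebra K C]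
variable {E : Type u} [AddCommGroup E] [Module K E] [LeftComodule K C E]

theorem IsInjectiveEnvelope.mem_of_ne_bot {S : Type u} [AddCommGroup S] [Module K S]
    [LeftComodule K C S] (hS : IsSimple K C S) {i : S →ₗ[K] E} (hi : IsInjectiveEnvelope K C i)
    (s : S) {U : Submodule (DualAlgebra K C)ᵐᵒᵖ E} (hU : U ≠ ⊥) : i s ∈ U := by
  let U' : Submodule K E := U.restrictScalars K
  have hU' : U' ≠ ⊥ := fun h => hU ((Submodule.restrictScalars_eq_bot_iff ..).1 h)
  have hcom : IsSubcomodule K C (U'.comap i) := isSubcomodule_of_smul_mem fun f x hx => by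
    rw [Submodule.mem_comap, isHom_iff.1 hi.isHom]
    exact U.smul_mem f hx
  rcases hS.2 _ hcom with h | h
  · refine absurd (hi.essential U' (isSubcomodule_of_smul_mem fun f x hx => U.smul_mem f hx) ?_) hU'
    rw [eq_bot_iff]
    rintro _ ⟨hx, z, rfl⟩
    have hz : z ∈ U'.comap i := hx
    rw [h, Submodule.mem_bot] at hz
    simp [hz]
  · have hs : s ∈ U'.comap i := h ▸ Submodule.mem_top
    exact hs

/-- Taking `X = E` and `a = 1` in `exists_smul_eq` gives `x = y · φ(-)(x)`. This says that `φ : C →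
E^*` is split by the morphism induced by evaluation at `y`, so `E^*` is a retract of `C`. -/
theorem isInjective_dual [FiniteDimensional K E] (hC : RightComodule.GeneratingCondition K C)
    (hE : IsInjective K C E) {s : E} (hs : s ≠ 0)
    (hess : ∀ U : Submodule (DualAlgebra K C)ᵐᵒᵖ E, U ≠ ⊥ → s ∈ U) :
    RightComodule.IsInjective K C (Module.Dual K E) := by
  obtain ⟨φ, hφ, c, hc⟩ : ∃ φ : C →ₗ[K] Module.Dual K E, RightComodule.IsHom K C φ ∧
      ∃ c : C, φ c s ≠ 0 := by
    by_contra! h'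
    have h : (⊤ : Submodule K (Module.Dual K E)) ≤ LinearMap.ker (Module.Dual.eval K E s) := by
      rw [← hC (Module.Dual K E), iSup_le_iff]
      rintro ⟨φ, hφ⟩ _ ⟨c, rfl⟩
      exact h' φ hφ c
    exact hs ((Module.forall_dual_apply_eq_zero_iff K s).1
      fun μ => h (Submodule.mem_top (x := μ)))
  obtain ⟨y, hy⟩ := exists_smul_eq hE hs hess (ι := LinearMap.id) (isHom_iff.2 fun _ _ => rfl)
    Function.injective_id (t := s) rfl hφ 1 ⟨c, by rwa [one_smul]⟩
  refine (RightComodule.isInjective_self K C).of_retract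
    (RightComodule.isHom_toSelf (Module.Dual.eval K E y)) hφ ?_
  ext μ x
  have := RightComodule.apply_toSelf (.toConv (φ.flip x) : DualAlgebra K C)
    (Module.Dual.eval K E y) μ
  rw [Module.Dual.eval_apply, dual_smul_apply] at this
  have hx := hy x
  rw [one_smul] at hx
  rw [← hx] at this
  exact this

/-- If the submodules of `E` that are not contained in `V` are all equal to `E`, then every nonzero
subcomodule of `E^*` contains the annihilator of `V`. -/
theorem dualAnnihilator_le [FiniteDimensional K E] {V : Submodule (DualAlgebra K C)ᵐᵒᵖ E}
    (hV : ∀ N : Submodule (DualAlgebra K C)ᵐᵒᵖ E, N ≠ ⊤ → N ≤ V)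
    {U : Submodule K (Module.Dual K E)} (hU : ∀ f : DualAlgebra K C, ∀ μ ∈ U, f • μ ∈ U)
    (hU0 : U ≠ ⊥) : (V.restrictScalars K).dualAnnihilator ≤ U := by
  -- The common zeros of `U` form a submodule, proper since `U ≠ 0`, hence contained in `V`; taking
  -- annihilators reverses the inclusion.
  let W : Submodule (DualAlgebra K C)ᵐᵒᵖ E :=
    { U.dualCoannihilator with
      smul_mem' := fun f x hx => by
        obtain ⟨f, rfl⟩ := MulOpposite.op_surjective f
        refine (Submodule.mem_dualCoannihilator _).2 fun μ hμ => ?_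
        rw [← dual_smul_apply]
        exact (Submodule.mem_dualCoannihilator _).1 hx _ (hU f μ hμ) }
  have hW : W ≠ ⊤ := fun h => hU0 <| by
    rw [eq_bot_iff]
    intro μ hμ
    refine LinearMap.ext fun x => ?_
    have hx : x ∈ W := h ▸ Submodule.mem_top
    exact (Submodule.mem_dualCoannihilator _).1 hx μ hμ
  have hle : U.dualCoannihilator ≤ V.restrictScalars K := hV W hW
  rw [← Subspace.dualCoannihilator_dualAnnihilator_eq (W := U)]
  exact Submodule.dualAnnihilator_anti hle

end LeftComodule

theorem proposition3p3 (K C : Type u) [Field K] [AddCommGroup C] [Module K C] [Coalgebra K C]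
    (hC : RightComodule.GeneratingCondition K C)
    (S E : Type u) [AddCommGroup S] [Module K S] [LeftComodule K C S]
    [AddCommGroup E] [Module K E] [LeftComodule K C E]
    (hS : LeftComodule.IsSimple K C S)
    (i : S →ₗ[K] E) (hi : LeftComodule.IsInjectiveEnvelope K C i)
    (hE : HasFiniteLoewyLength (DualAlgebra K C)ᵐᵒᵖ E) :
    FiniteDimensional K E ∧
      ∃ (T F : Type u) (_ : AddCommGroup T) (_ : Module K T) (_ : RightComodule K C T)
        (_ : AddCommGroup F) (_ : Module K F) (_ : RightComodule K C F) (j : T →ₗ[K] F),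
        RightComodule.IsSimple K C T ∧ RightComodule.IsInjectiveEnvelope K C j ∧
          LeftComodule.IsoDual K C E F := by
  have := hS.1
  obtain ⟨s₀, hs₀⟩ := exists_ne (0 : S)
  have hs : i s₀ ≠ 0 := fun h => hs₀ (hi.injective (h.trans (map_zero i).symm))
  have hess : ∀ U : Submodule (DualAlgebra K C)ᵐᵒᵖ E, U ≠ ⊥ → i s₀ ∈ U :=
    fun U hU => hi.mem_of_ne_bot hS s₀ hU
  have : Nontrivial E := nontrivial_of_ne _ _ hs
  obtain ⟨V, hVco, -⟩ := hE.exists_isCoatom (N := ⊥) bot_ne_top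
  -- Being the only maximal submodule, `V` contains every proper one.
  have hV : ∀ N : Submodule (DualAlgebra K C)ᵐᵒᵖ E, N ≠ ⊤ → N ≤ V := by
    intro N hN
    obtain ⟨V', hV', hle⟩ := hE.exists_isCoatom hN
    rwa [LeftComodule.isCoatom_unique hC hi.isInjective hs hess hVco hV']
  obtain ⟨x, hx⟩ : ∃ x, x ∉ V := by
    by_contra! h
    exact hVco.1 (eq_top_iff.2 fun x _ => h x)
  have hfin : FiniteDimensional K E := by
    have htop : Submodule.span (DualAlgebra K C)ᵐᵒᵖ {x} = ⊤ := by
      by_contra h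
      exact hx (hV _ h (Submodule.mem_span_singleton_self x))
    have := LeftComodule.finiteDimensional_span_singleton (K := K) (C := C) x
    refine Module.Finite.of_surjective
      ((Submodule.span (DualAlgebra K C)ᵐᵒᵖ {x}).subtype.restrictScalars K) fun y => ?_
    exact ⟨⟨y, htop ▸ Submodule.mem_top⟩, rfl⟩
  refine ⟨hfin, ?_⟩
  -- This is the dual of the simple quotient `E/V`, inside `E^*`.
  let T : Submodule K (Module.Dual K E) := (V.restrictScalars K).dualAnnihilator
  have hT : ∀ f : DualAlgebra K C, ∀ μ ∈ T, f • μ ∈ T := by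
    intro f μ hμ
    rw [Submodule.mem_dualAnnihilator] at hμ ⊢
    intro y hy
    rw [LeftComodule.dual_smul_apply]
    exact hμ _ (V.smul_mem _ hy)
  have hT0 : T ≠ ⊥ := by
    obtain ⟨μ, hμ, hle⟩ := Submodule.exists_le_ker_of_lt_top (V.restrictScalars K)
      (lt_top_iff_ne_top.2 fun h => hVco.1 ((Submodule.restrictScalars_eq_top_iff ..).1 h))
    refine fun h => hμ ?_
    have : μ ∈ T := (Submodule.mem_dualAnnihilator _).2 fun y hy => hle hy
    rwa [h, Submodule.mem_bot] at this
  let instT : RightComodule K C T := RightComodule.ofSubmodule T hT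
  refine ⟨T, Module.Dual K E, inferInstance, inferInstance, instT, inferInstance, inferInstance,
    inferInstance, T.subtype, ⟨Submodule.nontrivial_iff_ne_bot.2 hT0, fun U hU => ?_⟩,
    ⟨RightComodule.isHom_iff.2 fun f μ => RightComodule.coe_smul_ofSubmodule T hT f μ,
      T.injective_subtype, LeftComodule.isInjective_dual hC hi.isInjective hs hess,
      fun U hU h => ?_⟩, Module.evalEquiv K E, fun a y μ => ?_⟩
  · rw [or_iff_not_imp_left]
    intro hU0
    have hle : T ≤ U.map T.subtype := by
      refine LeftComodule.dualAnnihilator_le hV ?_ ?_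
      · rintro f _ ⟨μ, hμ, rfl⟩
        exact ⟨f • μ, hU.smul_mem f hμ, RightComodule.coe_smul_ofSubmodule T hT f μ⟩
      · exact fun h => hU0 (Submodule.map_injective_of_injective T.injective_subtype
          (h.trans (Submodule.map_bot _).symm))
    rw [eq_top_iff]
    rintro μ -
    obtain ⟨μ', hμ', h⟩ := hle μ.2
    rwa [← Subtype.ext h]
  -- A nonzero subcomodule contains `T`, so it cannot meet `T` trivially.
  · by_contra hU0
    have hle : T ≤ U := LeftComodule.dualAnnihilator_le hV (fun f μ hμ => hU.smul_mem f hμ) hU0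
    rw [Submodule.range_subtype, inf_eq_right.2 hle] at h
    exact hT0 h
  · exact (LeftComodule.dual_smul_apply a μ y).symm
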